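/- Let $\widehat{\mathbb Z}=\varprojlim_n \mathbb Z/n\mathbb Z$ be the ring of profinite integers. For a subgroup $H\subseteq \mathrm{GL}_2(\widehat{\mathbb Z})$ and a positive integer $n$, write $H(n)$ for the image of $H$ under the natural projection $\mathrm{GL}_2(\widehat{\mathbb Z})\to \mathrm{GL}_2(\mathbb Z/n\mathbb Z)$. Consider the subgroups $$\texttt{2Cs}=\{I\},\qquad \texttt{2B}=\left\langle\begin{pmatrix}1&1\\0&1\end{pmatrix}\right\rangle,\qquad \texttt{2Cn}=\left\langle\begin{pmatrix}0&1\\1&1\end{pmatrix}\right\rangle$$ of $\mathrm{GL}_2(\mathbb Z/2\mathbb Z)$, and let $\widehat{\texttt{2Cs}},\widehat{\texttt{2B}},\widehat{\texttt{2Cn}}\subseteq \mathrm{GL}_2(\widehat{\mathbb Z})$ be their full preimages under reduction modulo $2$. For a subgroup $K\subseteq \mathrm{GL}_2(\mathbb Z/n\mathbb Z)$, let $[K,K]$ denote its commutator subgroup and put $$\mathcal M(K)=\{L\subseteq K \text{ a subgroup}: \det(L)=\det(K)\text{ and }[L,L]=[K,K]\}.$$ Let $G\in\{\widehat{\texttt{2Cs}},\widehat{\texttt{2B}},\widehat{\texttt{2Cn}}\}$,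 put $m_0=72$ if $G=\widehat{\texttt{2Cs}}$ and $m_0=36$ if $G\in\{\widehat{\texttt{2B}},\widehat{\texttt{2Cn}}\}$, and let $k\in\{2,3\}$ be such that $m_0=2^k\cdot 9$. Then, for every subgroup $H\subseteq G$ with $\det(H(m_0))=(\mathbb Z/m_0\mathbb Z)^\times$, $$[H(m_0),H(m_0)]=[G(m_0),G(m_0)]\iff H(9)=\mathrm{GL}_2(\mathbb Z/9\mathbb Z)\ \text{ and }\ H(2^k)\in\mathcal M(G(2^k)).$$ -/

import Mathlib

open Matrix

/-- The ring of profinite integers, as the ring of compatible families of residue classes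
`(x n mod n)` indexed by the positive integers, i.e. `lim ℤ/nℤ` along divisibility. -/
def profiniteIntegers : Subring (∀ n : ℕ+, ZMod n) where
  carrier := {x | ∀ (m n : ℕ+) (h : (m : ℕ) ∣ (n : ℕ)), ZMod.castHom h (ZMod m) (x n) = x m}
  mul_mem' := by
    intro a b ha hb m n h
    simp only [Pi.mul_apply, map_mul, ha m n h, hb m n h]
  one_mem' := by
    intro m n h
    simp only [Pi.one_apply, map_one]
  add_mem' := by
    intro a b ha hb m n h
    simp only [Pi.add_apply, map_add, ha m n h, hb m n h]
  zero_mem' := by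
    intro m n h
    simp only [Pi.zero_apply, map_zero]
  neg_mem' := by
    intro a ha m n h
    simp only [Pi.neg_apply, map_neg, ha m n h]

/-- The ring of profinite integers as a type. -/
abbrev ZHat : Type := profiniteIntegers

/-- The projection from the profinite integers to `ℤ/nℤ`, for `n` a positive integer. -/
def ZHat.toZMod (n : ℕ) [NeZero n] : ZHat →+* ZMod n :=
  (Pi.evalRingHom (fun m : ℕ+ => ZMod m) ⟨n, NeZero.pos n⟩).comp profiniteIntegers.subtype

/-- The natural projection from `GL₂` of the profinite integers to `GL₂(ℤ/nℤ)`. -/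
def reduction (n : ℕ) [NeZero n] : GL (Fin 2) ZHat →* GL (Fin 2) (ZMod n) :=
  GeneralLinearGroup.map (ZHat.toZMod n)

/-- `H(n)`: the image in `GL₂(ℤ/nℤ)` of a subgroup `H` of `GL₂` of the profinite integers. -/
def imageMod (H : Subgroup (GL (Fin 2) ZHat)) (n : ℕ) [NeZero n] :
    Subgroup (GL (Fin 2) (ZMod n)) :=
  H.map (reduction n)

/-- The full preimage in `GL₂` of the profinite integers of a subgroup of `GL₂(ℤ/nℤ)`. -/
def fullPreimage {n : ℕ} [NeZero n] (G : Subgroup (GL (Fin 2) (ZMod n))) :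
    Subgroup (GL (Fin 2) ZHat) :=
  G.comap (reduction n)

/-- The image `det(G)` of a subgroup of `GL₂(ℤ/nℤ)` under the determinant. -/
def detImage {n : ℕ} (G : Subgroup (GL (Fin 2) (ZMod n))) : Subgroup (ZMod n)ˣ :=
  G.map GeneralLinearGroup.det

/-- `2Cs`, the trivial subgroup of `GL₂(ℤ/2ℤ)`. -/
def group2Cs : Subgroup (GL (Fin 2) (ZMod 2)) := ⊥

/-- `2B`, the subgroup of `GL₂(ℤ/2ℤ)` generated by `(1 1; 0 1)`. -/
def group2B : Subgroup (GL (Fin 2) (ZMod 2)) :=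
  Subgroup.closure {⟨!![1, 1; 0, 1], !![1, 1; 0, 1], by decide, by decide⟩}

/-- `2Cn`, the subgroup of `GL₂(ℤ/2ℤ)` generated by `(0 1; 1 1)`. -/
def group2Cn : Subgroup (GL (Fin 2) (ZMod 2)) :=
  Subgroup.closure {⟨!![0, 1; 1, 1], !![1, 1; 1, 0], by decide, by decide⟩}

/-- The set `ℳ(G)` of subgroups of `G` having the same determinant image and the same commutator
subgroup as `G`. -/
def fullCommDet {n : ℕ} (G : Subgroup (GL (Fin 2) (ZMod n))) :
    Set (Subgroup (GL (Fin 2) (ZMod n))) :=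
  {H | H ≤ G ∧ detImage H = detImage G ∧ ⁅H, H⁆ = ⁅G, G⁆}

open scoped commutatorElement

/-! Only two features of `G` matter: it contains the kernel of reduction mod 2, and it is abelian
mod 2. By the first, `[G, G]` maps onto SL₂(ℤ/9), so equality of commutators mod `m₀`, with full
determinant, forces `H(9)` to be everything. The converse is a Goursat-type argument: `[H, H] ∩
ker(mod 2^k)` still maps onto SL₂(ℤ/9) (`mem_imageMod_commutator_inf_ker`), because commutators in
`H` are trivial mod 2, so their fourth powers are trivial mod 8, while 4 is a unit mod 9. An element
of `[G, G]` matched mod `2^k` by `[H, H]` can then be corrected mod 9 without disturbing its 2-part.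
-/

/-- The unipotent matrix `(1 t; 0 1)`. -/
def upperUnipotent {R : Type*} [CommRing R] (t : R) : GL (Fin 2) R where
  val := !![1, t; 0, 1]
  inv := !![1, -t; 0, 1]
  val_inv := by ext i j; fin_cases i <;> fin_cases j <;> simp
  inv_val := by ext i j; fin_cases i <;> fin_cases j <;> simp

/-- The unipotent matrix `(1 0; t 1)`. -/
def lowerUnipotent {R : Type*} [CommRing R] (t : R) : GL (Fin 2) R where
  val := !![1, 0; t, 1]
  inv := !![1, 0; -t, 1]
  val_inv := by ext i j; fin_cases i <;> fin_cases j <;> simp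
  inv_val := by ext i j; fin_cases i <;> fin_cases j <;> simp

/-- The reflection `(-1 0; 0 1)`. -/
def diagReflection (R : Type*) [CommRing R] : GL (Fin 2) R where
  val := !![-1, 0; 0, 1]
  inv := !![-1, 0; 0, 1]
  val_inv := by ext i j; fin_cases i <;> fin_cases j <;> simp
  inv_val := by ext i j; fin_cases i <;> fin_cases j <;> simp

/-! ### Unipotent matrices and generation of SL₂ -/

section CommRing

variable {R S : Type*} [CommRing R] [CommRing S]

theorem map_upperUnipotent (f : R →+* S) (t : R) :
    GeneralLinearGroup.map f (upperUnipotent t) = upperUnipotent (f t) := by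
  ext i j; fin_cases i <;> fin_cases j <;> simp [upperUnipotent]

theorem map_lowerUnipotent (f : R →+* S) (t : R) :
    GeneralLinearGroup.map f (lowerUnipotent t) = lowerUnipotent (f t) := by
  ext i j; fin_cases i <;> fin_cases j <;> simp [lowerUnipotent]

theorem map_diagReflection (f : R →+* S) :
    GeneralLinearGroup.map f (diagReflection R) = diagReflection S := by
  ext i j; fin_cases i <;> fin_cases j <;> simp [diagReflection]

theorem upperUnipotent_zero : upperUnipotent (0 : R) = 1 := by
  ext i j; fin_cases i <;> fin_cases j <;> simp [upperUnipotent]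

theorem lowerUnipotent_zero : lowerUnipotent (0 : R) = 1 := by
  ext i j; fin_cases i <;> fin_cases j <;> simp [lowerUnipotent]

theorem upperUnipotent_mul (s t : R) :
    upperUnipotent s * upperUnipotent t = upperUnipotent (s + t) := by
  ext i j; fin_cases i <;> fin_cases j <;> simp [upperUnipotent, add_comm]

theorem lowerUnipotent_mul (s t : R) :
    lowerUnipotent s * lowerUnipotent t = lowerUnipotent (s + t) := by
  ext i j; fin_cases i <;> fin_cases j <;> simp [lowerUnipotent]

theorem upperUnipotent_pow (t : R) (n : ℕ) :
    upperUnipotent t ^ n = upperUnipotent (n * t) := by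
  induction n with
  | zero => simp [upperUnipotent_zero]
  | succ n ih => rw [pow_succ, ih, upperUnipotent_mul]; congr 1; push_cast; ring

theorem lowerUnipotent_pow (t : R) (n : ℕ) :
    lowerUnipotent t ^ n = lowerUnipotent (n * t) := by
  induction n with
  | zero => simp [lowerUnipotent_zero]
  | succ n ih => rw [pow_succ, ih, lowerUnipotent_mul]; congr 1; push_cast; ring

/-- Conjugation by the reflection negates the parameter `t`. -/
theorem commutator_diagReflection_upperUnipotent (t : R) :
    ⁅diagReflection R, upperUnipotent t⁆ = upperUnipotent (-2 * t) := by
  rw [commutatorElement_def, mul_inv_eq_iff_eq_mul, mul_inv_eq_iff_eq_mul]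
  ext i j; fin_cases i <;> fin_cases j <;> simp [upperUnipotent, diagReflection]
  ring

theorem commutator_diagReflection_lowerUnipotent (t : R) :
    ⁅diagReflection R, lowerUnipotent t⁆ = lowerUnipotent (-2 * t) := by
  rw [commutatorElement_def, mul_inv_eq_iff_eq_mul, mul_inv_eq_iff_eq_mul]
  ext i j; fin_cases i <;> fin_cases j <;> simp [lowerUnipotent, diagReflection]
  ring

/-- A matrix of determinant one with invertible lower left entry is a product of three
unipotent matrices. -/
theorem eq_upper_mul_lower_mul_upper (g : GL (Fin 2) R) (hg : g.det = 1) {x : R}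
    (hx : g 1 0 * x = 1) :
    g = upperUnipotent ((g 0 0 - 1) * x) * lowerUnipotent (g 1 0) *
      upperUnipotent ((g 1 1 - 1) * x) := by
  have hd : g 0 0 * g 1 1 - g 0 1 * g 1 0 = 1 := by
    have := congrArg Units.val hg
    rwa [GeneralLinearGroup.val_det_apply, Matrix.det_fin_two] at this
  ext i j
  fin_cases i <;> fin_cases j <;>
    simp [upperUnipotent, lowerUnipotent, Matrix.mul_apply, Fin.sum_univ_two]
  · linear_combination (1 - g 0 0) * hx
  · linear_combination (-g 0 1 - (g 0 0 - 1) * (g 1 1 - 1) * x) * hx - x * hd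
  · linear_combination (1 - g 1 1) * hx

end CommRing

/-- A subgroup of `GL₂(ℤ/9ℤ)` containing the unipotent matrices contains `SL₂(ℤ/9ℤ)`. -/
theorem mem_of_det_eq_one {N : Subgroup (GL (Fin 2) (ZMod 9))}
    (hu : ∀ t, upperUnipotent t ∈ N) (hl : ∀ t, lowerUnipotent t ∈ N)
    {g : GL (Fin 2) (ZMod 9)} (hg : g.det = 1) : g ∈ N := by
  have key : ∀ h : GL (Fin 2) (ZMod 9), h.det = 1 → (∃ x, h 1 0 * x = 1) → h ∈ N := by
    rintro h hd ⟨x, hx⟩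
    rw [eq_upper_mul_lower_mul_upper h hd hx]
    exact N.mul_mem (N.mul_mem (hu _) (hl _)) (hu _)
  -- In the local ring ℤ/9, if `c` is not a unit but `a` is, then `a + c` is a unit, and adding the
  -- first row to the second puts it at the lower left. Both being divisible by 3 contradicts
  -- determinant one.
  have hdec : ∀ a c : ZMod 9,
      (∃ x, c * x = 1) ∨ (∃ x, (a + c) * x = 1) ∨ (3 * a = 0 ∧ 3 * c = 0) := by decide
  rcases hdec (g 0 0) (g 1 0) with h | ⟨x, hx⟩ | ⟨ha, hc⟩
  · exact key g hg h
  · have hdl : (lowerUnipotent (1 : ZMod 9)).det = 1 := by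
      ext; simp [lowerUnipotent, Matrix.det_fin_two]
    have := key (lowerUnipotent 1 * g) (by rw [map_mul, hdl, hg, one_mul])
      ⟨x, by simpa [lowerUnipotent, Matrix.mul_apply, Fin.sum_univ_two] using hx⟩
    exact (N.mul_mem_cancel_left (hl 1)).1 this
  · have hd : g 0 0 * g 1 1 - g 0 1 * g 1 0 = 1 := by
      have := congrArg Units.val hg
      rwa [GeneralLinearGroup.val_det_apply, Matrix.det_fin_two] at this
    have h3 : (3 : ZMod 9) = 0 := by
      linear_combination g 1 1 * ha - g 0 1 * hc - 3 * hd
    exact absurd h3 (by decide)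

/-! ### Compatibility of the reductions -/

theorem map_castHom_reduction {m n : ℕ} [NeZero m] [NeZero n] (h : m ∣ n)
    (g : GL (Fin 2) ZHat) :
    GeneralLinearGroup.map (ZMod.castHom h (ZMod m)) (reduction n g) = reduction m g := by
  ext i j
  exact (g i j).2 ⟨m, NeZero.pos m⟩ ⟨n, NeZero.pos n⟩ h

theorem imageMod_eq_map {m n : ℕ} [NeZero m] [NeZero n] (h : m ∣ n)
    (H : Subgroup (GL (Fin 2) ZHat)) :
    imageMod H m = (imageMod H n).map (GeneralLinearGroup.map (ZMod.castHom h (ZMod m))) := by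
  rw [imageMod, imageMod, Subgroup.map_map]
  congr 1
  ext1 g
  exact (map_castHom_reduction h g).symm

theorem commutator_imageMod (H : Subgroup (GL (Fin 2) ZHat)) (n : ℕ) [NeZero n] :
    ⁅imageMod H n, imageMod H n⁆ = imageMod ⁅H, H⁆ n :=
  (Subgroup.map_commutator H H (reduction n)).symm

theorem detImage_imageMod_eq_top {m n : ℕ} [NeZero m] [NeZero n] (h : m ∣ n)
    {H : Subgroup (GL (Fin 2) ZHat)} (hdet : detImage (imageMod H n) = ⊤) :
    detImage (imageMod H m) = ⊤ := by
  rw [eq_top_iff]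
  rintro u -
  obtain ⟨v, rfl⟩ := ZMod.unitsMap_surjective h u
  have hv : v ∈ detImage (imageMod H n) := hdet ▸ Subgroup.mem_top v
  obtain ⟨g, hg, rfl⟩ := hv
  refine ⟨GeneralLinearGroup.map (ZMod.castHom h (ZMod m)) g, ?_, ?_⟩
  · rw [imageMod_eq_map h]
    exact Subgroup.mem_map_of_mem _ hg
  · exact GeneralLinearGroup.map_det _ g

/-- The Chinese remainder theorem for reductions of `GL₂`. -/
theorem reduction_mul_injective {m n : ℕ} [NeZero m] [NeZero n] [NeZero (m * n)]
    (hmn : m.Coprime n) {g h : GL (Fin 2) ZHat} (hm : reduction m g = reduction m h)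
    (hn : reduction n g = reduction n h) : reduction (m * n) g = reduction (m * n) h := by
  rw [← map_castHom_reduction (dvd_mul_right m n) g,
    ← map_castHom_reduction (dvd_mul_right m n) h] at hm
  rw [← map_castHom_reduction (dvd_mul_left n m) g,
    ← map_castHom_reduction (dvd_mul_left n m) h] at hn
  ext i j
  have hm' := congrArg (fun x : GL (Fin 2) (ZMod m) => x i j) hm
  have hn' := congrArg (fun x : GL (Fin 2) (ZMod n) => x i j) hn
  have hfst : (RingHom.fst (ZMod m) (ZMod n)).comp (ZMod.chineseRemainder hmn).toRingHom =
      ZMod.castHom (dvd_mul_right m n) (ZMod m) := Subsingleton.elim _ _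
  have hsnd : (RingHom.snd (ZMod m) (ZMod n)).comp (ZMod.chineseRemainder hmn).toRingHom =
      ZMod.castHom (dvd_mul_left n m) (ZMod n) := Subsingleton.elim _ _
  rw [← hfst] at hm'
  rw [← hsnd] at hn'
  exact (ZMod.chineseRemainder hmn).injective (Prod.ext hm' hn')

/-- A matrix over `ℤ/qℤ` with `q ∣ 8` that is trivial modulo `2` has trivial fourth power. -/
theorem reduction_pow_four_eq_one {q : ℕ} [NeZero q] (hq : q ∣ 8) (h2 : 2 ∣ q)
    {g : GL (Fin 2) ZHat} (hg : reduction 2 g = 1) : reduction q (g ^ 4) = 1 := by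
  have hA : ∀ i j, ∃ a : ZMod q,
      (reduction q g) i j = (1 : Matrix (Fin 2) (Fin 2) (ZMod q)) i j + 2 * a := by
    intro i j
    have hc := congrArg (fun x : GL (Fin 2) (ZMod 2) => x i j) hg
    rw [← map_castHom_reduction h2 g] at hc
    have h1 : ZMod.castHom h2 (ZMod 2) ((1 : Matrix (Fin 2) (Fin 2) (ZMod q)) i j) =
        (1 : Matrix (Fin 2) (Fin 2) (ZMod 2)) i j := by
      rw [Matrix.one_apply, Matrix.one_apply]; split_ifs <;> simp only [map_one, map_zero]
    have h0 : ZMod.castHom h2 (ZMod 2)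
        ((reduction q g) i j - (1 : Matrix (Fin 2) (Fin 2) (ZMod q)) i j) = 0 := by
      rw [map_sub, h1, sub_eq_zero]
      exact hc
    generalize (reduction q g) i j = x at h0 ⊢
    generalize (1 : Matrix (Fin 2) (Fin 2) (ZMod q)) i j = y at h0 ⊢
    obtain ⟨n, hn⟩ := ZMod.natCast_zmod_surjective (x - y)
    rw [← hn, map_natCast, ZMod.natCast_eq_zero_iff] at h0
    obtain ⟨l, rfl⟩ := h0
    exact ⟨l, by push_cast at hn; linear_combination -hn⟩
  choose A hA using hA
  have hM : (reduction q g : Matrix (Fin 2) (Fin 2) (ZMod q)) = 1 + 2 • Matrix.of A := by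
    ext i j
    simpa using hA i j
  apply Units.ext
  rw [map_pow, Units.val_pow_eq_pow_val, hM, Units.val_one]
  set B := Matrix.of A
  -- The non-constant coefficients 8, 24, 32, 16 are all divisible by 8.
  have h : (1 + 2 • B) ^ 4 = 1 + 8 • (B + 3 • B ^ 2 + 4 • B ^ 3 + 2 • B ^ 4) := by
    noncomm_ring
  rw [h, ← Nat.cast_smul_eq_nsmul (ZMod q), (ZMod.natCast_eq_zero_iff 8 q).2 hq, zero_smul,
    add_zero]

/-! ### Commutator subgroups modulo 9 and the equivalence -/

section Subgroups

variable {G H : Subgroup (GL (Fin 2) ZHat)}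

/-- The commutator subgroup of the image in `GL₂(ℤ/9ℤ)` of a group containing the matrices that
are trivial modulo `2` contains `SL₂(ℤ/9ℤ)`. -/
theorem mem_imageMod_commutator_of_det_eq_one (hG : (reduction 2).ker ≤ G)
    {g : GL (Fin 2) (ZMod 9)} (hg : g.det = 1) : g ∈ imageMod ⁅G, G⁆ 9 := by
  have hd : diagReflection ZHat ∈ G := hG <| by
    rw [MonoidHom.mem_ker, reduction, map_diagReflection]
    ext i j; fin_cases i <;> fin_cases j <;> simp [diagReflection]
  have h2 : ∀ s : ZHat, ZHat.toZMod 2 (2 * s) = 0 := fun s => by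
    rw [map_mul, map_ofNat, show (OfNat.ofNat 2 : ZMod 2) = 0 from rfl, zero_mul]
  -- The parameter `4t` is even, so its unipotent lies in `G`, and `-2 * 4 = -8` is 1 mod 9.
  have hsurj : ∀ t : ZMod 9, ZHat.toZMod 9 (-2 * (2 * (2 * (t.val : ZHat)))) = t := by
    intro t
    simp only [map_mul, map_neg, map_ofNat, map_natCast, ZMod.natCast_zmod_val]
    revert t; decide
  refine mem_of_det_eq_one (fun t => ?_) (fun t => ?_) hg
  · refine ⟨_, Subgroup.commutator_mem_commutator hd
      (hG (?_ : upperUnipotent (2 * (2 * (t.val : ZHat))) ∈ _)), ?_⟩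
    · rw [MonoidHom.mem_ker, reduction, map_upperUnipotent, h2, upperUnipotent_zero]
    · rw [commutator_diagReflection_upperUnipotent, reduction, map_upperUnipotent, hsurj]
  · refine ⟨_, Subgroup.commutator_mem_commutator hd
      (hG (?_ : lowerUnipotent (2 * (2 * (t.val : ZHat))) ∈ _)), ?_⟩
    · rw [MonoidHom.mem_ker, reduction, map_lowerUnipotent, h2, lowerUnipotent_zero]
    · rw [commutator_diagReflection_lowerUnipotent, reduction, map_lowerUnipotent, hsurj]

/-- If `H` surjects onto `GL₂(ℤ/9ℤ)` and is abelian modulo `2`, then the elements of its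
commutator subgroup that are trivial modulo `q ∣ 8` surject onto `SL₂(ℤ/9ℤ)`. -/
theorem mem_imageMod_commutator_inf_ker {q : ℕ} [NeZero q] (hq : q ∣ 8) (h2 : 2 ∣ q)
    (hcomm : ∀ a ∈ H, ∀ b ∈ H, reduction 2 ⁅a, b⁆ = 1) (h9 : imageMod H 9 = ⊤)
    {g : GL (Fin 2) (ZMod 9)} (hg : g.det = 1) :
    g ∈ imageMod (⁅H, H⁆ ⊓ (reduction q).ker) 9 := by
  have hsurj : ∀ x, ∃ a ∈ H, reduction 9 a = x := fun x =>
    Subgroup.mem_map.1 (show x ∈ imageMod H 9 from h9 ▸ Subgroup.mem_top x)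
  obtain ⟨a, ha, ha'⟩ := hsurj (diagReflection _)
  have key : ∀ b ∈ H, ⁅diagReflection (ZMod 9), ⁅diagReflection (ZMod 9), reduction 9 b⁆ ^ 4⁆ ∈
      imageMod (⁅H, H⁆ ⊓ (reduction q).ker) 9 := by
    intro b hb
    have hab : ⁅a, b⁆ ∈ H := Subgroup.commutator_le_self H
      (Subgroup.commutator_mem_commutator ha hb)
    refine ⟨⁅a, ⁅a, b⁆ ^ 4⁆, ⟨Subgroup.commutator_mem_commutator ha (H.pow_mem hab 4), ?_⟩, ?_⟩
    · change reduction q _ = 1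
      rw [map_commutatorElement,
        reduction_pow_four_eq_one hq h2 (hcomm a ha b hb), commutatorElement_one_right]
    · rw [map_commutatorElement, map_pow, map_commutatorElement, ha']
  -- Each commutator contributes -2 and the power 4; starting from `4t` the total factor is 64,
  -- which is 1 mod 9.
  have hcoef : ∀ t : ZMod 9, -2 * (((4 : ℕ) : ZMod 9) * (-2 * (4 * t))) = t := by decide
  refine mem_of_det_eq_one (fun t => ?_) (fun t => ?_) hg
  · obtain ⟨b, hb, hb'⟩ := hsurj (upperUnipotent (4 * t))
    have := key b hb
    rwa [hb', commutator_diagReflection_upperUnipotent, upperUnipotent_pow,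
      commutator_diagReflection_upperUnipotent, hcoef] at this
  · obtain ⟨b, hb, hb'⟩ := hsurj (lowerUnipotent (4 * t))
    have := key b hb
    rwa [hb', commutator_diagReflection_lowerUnipotent, lowerUnipotent_pow,
      commutator_diagReflection_lowerUnipotent, hcoef] at this

theorem commutator_imageMod_eq_iff {q : ℕ} [NeZero q] [NeZero (q * 9)] (hq : q ∣ 8) (h2 : 2 ∣ q)
    (hker : (reduction 2).ker ≤ G) (hcomm : ∀ a ∈ G, ∀ b ∈ G, reduction 2 ⁅a, b⁆ = 1)
    (hHG : H ≤ G) (hdet : detImage (imageMod H (q * 9)) = ⊤) :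
    ⁅imageMod H (q * 9), imageMod H (q * 9)⁆ = ⁅imageMod G (q * 9), imageMod G (q * 9)⁆ ↔
      imageMod H 9 = ⊤ ∧ imageMod H q ∈ fullCommDet (imageMod G q) := by
  have hcop : q.Coprime 9 := Nat.Coprime.coprime_dvd_left hq (by norm_num)
  simp only [fullCommDet, Set.mem_ofPred_eq, commutator_imageMod]
  constructor
  · intro h
    have h9 : imageMod ⁅H, H⁆ 9 = imageMod ⁅G, G⁆ 9 := by
      rw [imageMod_eq_map (dvd_mul_left 9 q), h, ← imageMod_eq_map]
    have hHq : detImage (imageMod H q) = ⊤ := detImage_imageMod_eq_top (dvd_mul_right q 9) hdet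
    have hle : imageMod H q ≤ imageMod G q := Subgroup.map_mono hHG
    refine ⟨?_, hle, ?_, ?_⟩
    · rw [eq_top_iff]
      rintro x -
      have hx : x.det ∈ detImage (imageMod H 9) :=
        detImage_imageMod_eq_top (dvd_mul_left 9 q) hdet ▸ Subgroup.mem_top _
      obtain ⟨y, hy, hyx⟩ := hx
      have hxy : y⁻¹ * x ∈ imageMod ⁅H, H⁆ 9 := by
        rw [h9]
        exact mem_imageMod_commutator_of_det_eq_one hker
          (by rw [map_mul, map_inv, hyx, inv_mul_cancel])
      exact ((imageMod H 9).mul_mem_cancel_left ((imageMod H 9).inv_mem hy)).1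
        (Subgroup.map_mono (Subgroup.commutator_le_self H) hxy)
    -- `H(q)` already has full determinant, hence so does the larger `G(q)`.
    · rw [hHq, eq_comm, eq_top_iff, ← hHq]
      exact Subgroup.map_mono hle
    · rw [imageMod_eq_map (dvd_mul_right q 9), h, ← imageMod_eq_map]
  · rintro ⟨h9, -, -, hc⟩
    have hle : ⁅H, H⁆ ≤ ⁅G, G⁆ := Subgroup.commutator_mono hHG hHG
    refine le_antisymm (Subgroup.map_mono hle) ?_
    rintro _ ⟨x, hx, rfl⟩
    obtain ⟨y, hy, hyx⟩ : reduction q x ∈ imageMod ⁅H, H⁆ q :=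
      hc ▸ Subgroup.mem_map_of_mem _ hx
    have hdet1 : ∀ z ∈ ⁅G, G⁆, z.det = 1 := fun z hz => by
      have : ⁅G, G⁆ ≤ (GeneralLinearGroup.det : GL (Fin 2) ZHat →* ZHatˣ).ker :=
        Subgroup.commutator_le.2 fun a _ b _ => by
          rw [MonoidHom.mem_ker, map_commutatorElement, commutatorElement_eq_one_iff_mul_comm,
            mul_comm]
      exact this hz
    have hz : y⁻¹ * x ∈ ⁅G, G⁆ := mul_mem (inv_mem (hle hy)) hx
    -- The correction `z` repairs `y` mod 9 and is trivial mod `q`.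
    obtain ⟨z, ⟨hzH, hzq⟩, hz9⟩ := mem_imageMod_commutator_inf_ker hq h2
      (fun a ha b hb => hcomm a (hHG ha) b (hHG hb)) h9
      (show (reduction 9 (y⁻¹ * x)).det = 1 by
        rw [reduction, GeneralLinearGroup.map_det, hdet1 _ hz, map_one])
    refine ⟨y * z, mul_mem hy hzH, reduction_mul_injective hcop ?_ ?_⟩
    · rw [map_mul, MonoidHom.mem_ker.1 hzq, mul_one, hyx]
    · rw [map_mul, hz9, ← map_mul, mul_inv_cancel_left]

theorem ker_reduction_le_fullPreimage {n : ℕ} [NeZero n] (K : Subgroup (GL (Fin 2) (ZMod n))) :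
    (reduction n).ker ≤ fullPreimage K := fun g hg => by
  rw [fullPreimage, Subgroup.mem_comap, MonoidHom.mem_ker.1 hg]
  exact K.one_mem

theorem reduction_commutator_eq_one {n : ℕ} [NeZero n] {K : Subgroup (GL (Fin 2) (ZMod n))}
    {x : GL (Fin 2) (ZMod n)} (hK : K ≤ Subgroup.zpowers x) :
    ∀ a ∈ fullPreimage K, ∀ b ∈ fullPreimage K, reduction n ⁅a, b⁆ = 1 := by
  intro a ha b hb
  obtain ⟨i, hi⟩ := Subgroup.mem_zpowers_iff.1 (hK ha)
  obtain ⟨j, hj⟩ := Subgroup.mem_zpowers_iff.1 (hK hb)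
  rw [map_commutatorElement, ← hi, ← hj, commutatorElement_eq_one_iff_mul_comm]
  exact zpow_mul_comm x i j

end Subgroups

theorem propositionP (G : Subgroup (GL (Fin 2) ZHat)) (m₀ : ℕ) [NeZero m₀]
    (hG : (G = fullPreimage group2Cs ∧ m₀ = 72) ∨
      ((G = fullPreimage group2B ∨ G = fullPreimage group2Cn) ∧ m₀ = 36))
    (k : ℕ) (hk : m₀ = 2 ^ k * 9)
    (H : Subgroup (GL (Fin 2) ZHat)) (hHG : H ≤ G)
    (hdet : detImage (imageMod H m₀) = ⊤) :
    ⁅imageMod H m₀, imageMod H m₀⁆ = ⁅imageMod G m₀, imageMod G m₀⁆ ↔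
      imageMod H 9 = ⊤ ∧ imageMod H (2 ^ k) ∈ fullCommDet (imageMod G (2 ^ k)) := by
  have hq : 2 ^ k = 8 ∨ 2 ^ k = 4 := by omega
  have h8 : 2 ^ k ∣ 8 := by rcases hq with h | h <;> norm_num [h]
  have h2 : 2 ∣ 2 ^ k := by rcases hq with h | h <;> norm_num [h]
  -- Each of the three groups mod 2 is cyclic, hence abelian.
  have hG' : (reduction 2).ker ≤ G ∧ ∀ a ∈ G, ∀ b ∈ G, reduction 2 ⁅a, b⁆ = 1 := by
    rcases hG with ⟨rfl, -⟩ | ⟨rfl | rfl, -⟩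
    · exact ⟨ker_reduction_le_fullPreimage _,
        reduction_commutator_eq_one (x := 1) (by rw [group2Cs]; exact bot_le)⟩
    · exact ⟨ker_reduction_le_fullPreimage _,
        reduction_commutator_eq_one (by rw [group2B, Subgroup.zpowers_eq_closure])⟩
    · exact ⟨ker_reduction_le_fullPreimage _,
        reduction_commutator_eq_one (by rw [group2Cn, Subgroup.zpowers_eq_closure])⟩
  subst hk
  exact commutator_imageMod_eq_iff h8 h2 hG'.1 hG'.2 hHG hdet
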